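/- Let $A(G)$ be the adjacency matrix of a finite simple graph $G$ on $n$ vertices, with eigenvalues $\lambda_1(G),\dots,\lambda_n(G)$, and let $S_k(G)=\sum_{i=1}^n\lambda_i(G)^k$ for $k=0,1,\dots,n-1$. For graphs $G_1,G_2$ on $n$ vertices write $G_1\prec_s G_2$ ($G_1$ comes before $G_2$ in the $S$-order) if for some $k\in\{1,\dots,n-1\}$ we have $S_i(G_1)=S_i(G_2)$ for $0\le i\le k-1$ and $S_k(G_1)<S_k(G_2)$. Let $\mathscr T_n^{p,q}$ be the set of trees on $n=p+q$ vertices whose vertex set has a bipartition into classes with $p$ and $q$ vertices. For $k,l\ge 0$ with $k+l+1\le p$ and $l+2\le q$, let $B_{p,q}^{k,l}\in\mathscr T_n^{p,q}$ be the tree with $p$ white and $q$ black vertices in which one white vertex $x$ is adjacent to all $q$ black vertices and the other $p-1$ white vertices are leaves: $p-1-k-l$ of them are attached to a black vertex $u$, $k$ of them to another black vertex $v$, and the remaining $l$ to $l$ further distinct black vertices, one to each. **Theorem.** Let $p=q$. (i) If $p\ge 5$, the last four trees, in the $S$-order, among $\mathscr T_n^{p,q}$ are, from fourth-last to last, $B_{p,q}^{0,2},\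 B_{p,q}^{2,0},\ B_{p,q}^{0,1},\ B_{p,q}^{0,0}$. That is, $B_{p,q}^{0,2}\prec_s B_{p,q}^{2,0}\prec_s B_{p,q}^{0,1}\prec_s B_{p,q}^{0,0}$, and $T\prec_s B_{p,q}^{0,2}$ for every $T\in\mathscr T_n^{p,q}$ that is isomorphic to none of these four trees. (ii) If $p=4$, then $B_{p,q}^{2,0}\cong B_{p,q}^{0,1}$, and in the same sense the last three trees, in the $S$-order, among $\mathscr T_n^{p,q}$ are, from third-last to last, $B_{p,q}^{0,2},\ B_{p,q}^{0,1},\ B_{p,q}^{0,0}$. -/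

import Mathlib

/-- The `k`-th spectral moment of a finite graph: the sum of the `k`-th powers of the
eigenvalues (with multiplicity) of its real adjacency matrix. -/
noncomputable def spectralMoment {V : Type*} [Fintype V] (G : SimpleGraph V) (k : ℕ) : ℝ := by
  classical
  exact ∑ i, (show (G.adjMatrix ℝ).IsHermitian from
    (Matrix.conjTranspose_eq_transpose_of_trivial _).trans
      (SimpleGraph.isSymm_adjMatrix G)).eigenvalues i ^ k

/-- `G` comes strictly before `H` in the `S`-order. The moments `S₀` are the numbers of vertices,
so only graphs with equally many vertices are comparable. -/
def SBefore {V W : Type*} [Fintype V] [Fintype W] (G : SimpleGraph V) (H : SimpleGraph W) : Prop :=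
  ∃ k : ℕ, 1 ≤ k ∧ k < Fintype.card V ∧
    (∀ i < k, spectralMoment G i = spectralMoment H i) ∧ spectralMoment G k < spectralMoment H k

/-- `G` is a tree with a `(p, q)`-bipartition. -/
def IsTreeWithBipartition (p q : ℕ) {V : Type*} [Fintype V] (G : SimpleGraph V) : Prop :=
  G.IsTree ∧ ∃ s t : Set V, G.IsBipartiteWith s t ∧ s ∪ t = Set.univ ∧ s.ncard = p ∧ t.ncard = q

/-- In `treeB p q k l`, the black vertex to which the `i`-th white vertex (`1 ≤ i`) is attached:
white vertices `1, …, k` hang on the black vertex `v = 1`; the next `l` white vertices hang on the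
`l` distinct black vertices `2, …, l + 1`; all the others hang on the black vertex `u = 0`. -/
def treeBAttach (k l i : ℕ) : ℕ :=
  if i ≤ k then 1 else if i ≤ k + l then i - k + 1 else 0

/-- The tree `B_{p,q}^{k,l}` with white vertices `Fin p` and black vertices `Fin q`
(meaningful for `k + l + 1 ≤ p` and `l + 2 ≤ q`). The white vertex `0` is joined to all black
vertices, `u` carries `p - 1 - k - l` white leaves, `v` carries `k` white leaves, and `l` further
black vertices carry one white leaf each. Thus `u` and `v` have degrees `p - k - l` and `k + 1`,
and the convention `deg v ≤ deg u` reads `2 * k + l + 1 ≤ p`. -/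
def treeB (p q k l : ℕ) : SimpleGraph (Fin p ⊕ Fin q) :=
  SimpleGraph.fromRel fun a b =>
    ∃ (i : Fin p) (j : Fin q), a = Sum.inl i ∧ b = Sum.inr j ∧
      ((i : ℕ) = 0 ∨ (j : ℕ) = treeBAttach k l i)

universe u

/-- The members of `L` are, in this order and up to isomorphism, the last `L.length` trees in the
`S`-order among all trees with a `(p, q)`-bipartition: they are such trees, each comes strictly
before all later ones, and every other such tree comes strictly before all of them. -/
def AreLastTrees (p q : ℕ) (L : List (SimpleGraph (Fin p ⊕ Fin q))) : Prop :=
  (∀ G ∈ L, IsTreeWithBipartition p q G) ∧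
  L.Pairwise (fun G H => SBefore G H) ∧
  ∀ (V : Type u) [Fintype V] (T : SimpleGraph V), IsTreeWithBipartition p q T →
    (∀ G ∈ L, ¬ Nonempty (T ≃g G)) → ∀ G ∈ L, SBefore T G

/-!
Odd moments of a bipartite graph vanish, and `S₀` and `S₂` count vertices and edges, so two trees on
`n` vertices can first differ at `S₄`. Up to a constant this is twice the sum of the squares of the
excesses `deg v - 1`, and the excesses on one side of the bipartition form a partition of the size
of the other side minus one.

If a vertex is adjacent to the whole opposite class, the excesses on that opposite class form a
partition of `p - 1` determining the tree. The squared adjacency matrix restricted to the opposite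
class is the all-ones matrix plus the diagonal matrix of the excesses, so `S₄` and `S₆` compare the
second and third power sums of the partitions. The largest among the partitions of `m` are `{m}`,
`{m - 1, 1}`, `{m - 2, 2}` and `{m - 2, 1, 1}`, which belong to the trees `treeB`; for `m = 6` the
partition `{3, 3}` ties with `{4, 1, 1}` in the squares and loses in the cubes.

If no vertex is adjacent to the whole opposite class, both partitions have largest part at most
`p - 2`, hence square sums at most `(p - 2)² + 1`; in total this is two less than the
`(p - 1)² + (p - 3)² + 2` of `treeB p p 0 2`.
-/

open Finset Matrix

section Moments

theorem trace_pow_eq_sum_eigenvalues {𝕜 n : Type*} [RCLike 𝕜] [Fintype n] [DecidableEq n]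
    {A : Matrix n n 𝕜} (hA : A.IsHermitian) (k : ℕ) :
    (A ^ k).trace = ∑ i, (hA.eigenvalues i : 𝕜) ^ k := by
  conv_lhs => rw [hA.spectral_theorem, ← map_pow, Unitary.conjStarAlgAut_apply, trace_mul_cycle]
  simp [diagonal_pow, trace_diagonal]

theorem mul_pow_mul_comm {m n R : Type*} [Fintype m] [Fintype n] [DecidableEq m] [DecidableEq n]
    [Semiring R] (B : Matrix m n R) (C : Matrix n m R) (k : ℕ) :
    (B * C) ^ k * B = B * (C * B) ^ k := by
  induction k with
  | zero => simp
  | succ k ih => simp only [pow_succ', Matrix.mul_assoc, ih]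

theorem trace_mul_pow_comm {m n R : Type*} [Fintype m] [Fintype n] [DecidableEq m] [DecidableEq n]
    [CommSemiring R] (B : Matrix m n R) (C : Matrix n m R) {k : ℕ} (hk : k ≠ 0) :
    ((B * C) ^ k).trace = ((C * B) ^ k).trace := by
  obtain ⟨k, rfl⟩ := Nat.exists_eq_succ_of_ne_zero hk
  rw [pow_succ, ← Matrix.mul_assoc, mul_pow_mul_comm, trace_mul_comm, ← Matrix.mul_assoc,
    ← pow_succ']

theorem trace_ones_add_diagonal_pow_three {n R : Type*} [Fintype n] [DecidableEq n]
    [CommSemiring R] (d : n → R) : ((of (fun _ _ => 1) + diagonal d) ^ 3).trace =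
      Fintype.card n ^ 3 + 3 * Fintype.card n * ∑ i, d i + 3 * ∑ i, d i ^ 2 + ∑ i, d i ^ 3 := by
  simp only [pow_two, pow_three, Matrix.mul_add, Matrix.add_mul, trace_add]
  simp only [Matrix.trace, diag_apply, Matrix.mul_apply, of_apply, diagonal_apply, mul_ite, ite_mul,
    mul_one, one_mul, mul_zero, zero_mul, Finset.sum_ite_eq, Finset.sum_ite_eq', Finset.mem_univ,
    if_true, Finset.sum_const, Finset.card_univ, nsmul_eq_mul]
  simp only [← Finset.mul_sum, ← Finset.sum_mul]
  ring

variable {V : Type*} [Fintype V] {G : SimpleGraph V}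

theorem spectralMoment_eq_trace [DecidableEq V] (G : SimpleGraph V) [DecidableRel G.Adj] (k : ℕ) :
    spectralMoment G k = (G.adjMatrix ℝ ^ k).trace := by
  have isHermitian : (G.adjMatrix ℝ).IsHermitian :=
    (conjTranspose_eq_transpose_of_trivial _).trans G.isSymm_adjMatrix
  simp only [trace_pow_eq_sum_eigenvalues isHermitian, spectralMoment, RCLike.ofReal_real_eq_id, id]
  congr!

theorem spectralMoment_zero (G : SimpleGraph V) : spectralMoment G 0 = Fintype.card V := by
  simp [spectralMoment]

theorem spectralMoment_two (G : SimpleGraph V) [DecidableRel G.Adj] :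
    spectralMoment G 2 = ∑ v, (G.degree v : ℝ) := by
  classical
  simp only [spectralMoment_eq_trace, pow_two, Matrix.trace, diag_apply,
    SimpleGraph.adjMatrix_mul_self_apply_self]

theorem spectralMoment_eq_zero_of_odd (hG : G.IsBipartite) {k : ℕ} (hk : Odd k) :
    spectralMoment G k = 0 := by
  classical
  have no_closed_walk (v : V) : IsEmpty {w : G.Walk v v | w.length = k} := by
    refine ⟨fun ⟨w, hw⟩ => ?_⟩
    have c : G.Coloring Bool := hG.toColoring (by simp)
    exact not_iff_self ((c.odd_length_iff_not_congr w).1 (hw ▸ hk))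
  rw [spectralMoment_eq_trace]
  refine Finset.sum_eq_zero fun v _ => ?_
  rw [diag_apply, SimpleGraph.adjMatrix_pow_apply_eq_card_walk, Fintype.card_eq_zero,
    Nat.cast_zero]

end Moments

section Codegree

variable {V : Type*} [Fintype V] {G : SimpleGraph V} [DecidableRel G.Adj]

theorem adjMatrix_sq_apply [DecidableEq V] (u v : V) :
    (G.adjMatrix ℝ ^ 2) u v = #(G.neighborFinset u ∩ G.neighborFinset v) := by
  rw [pow_two, SimpleGraph.adjMatrix_mul_apply, ← Finset.filter_mem_eq_inter]
  simp [SimpleGraph.adjMatrix_apply, SimpleGraph.adj_comm]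

theorem adjMatrix_sq_apply_self [DecidableEq V] (v : V) : (G.adjMatrix ℝ ^ 2) v v = G.degree v := by
  rw [pow_two, SimpleGraph.adjMatrix_mul_self_apply_self]

theorem card_neighborFinset_inter_le_one [DecidableEq V] (hG : G.IsAcyclic) {u v : V}
    (huv : u ≠ v) :
    #(G.neighborFinset u ∩ G.neighborFinset v) ≤ 1 := by
  have isPath {c} (hu : G.Adj u c) (hv : G.Adj v c) :
      (SimpleGraph.Walk.cons hu (.cons hv.symm .nil)).IsPath := by
    simp [SimpleGraph.Walk.cons_isPath_iff, hu.ne, hv.ne.symm, huv]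
  refine Finset.card_le_one.2 fun a ha b hb => ?_
  simp only [Finset.mem_inter, SimpleGraph.mem_neighborFinset] at ha hb
  have path_eq := (hG.subsingleton_path u v).elim ⟨_, isPath ha.1 ha.2⟩ ⟨_, isPath hb.1 hb.2⟩
  simpa using congrArg (fun p : G.Path u v => p.1.support) path_eq

theorem sum_adjMatrix_sq [DecidableEq V] :
    ∑ u, ∑ v, (G.adjMatrix ℝ ^ 2) u v = ∑ w, (G.degree w : ℝ) ^ 2 :=
  calc ∑ u, ∑ v, (G.adjMatrix ℝ ^ 2) u v
      = 1 ⬝ᵥ (G.adjMatrix ℝ ^ 2) *ᵥ 1 := by simp [dotProduct, mulVec]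
    _ = (1 ᵥ* G.adjMatrix ℝ) ⬝ᵥ (G.adjMatrix ℝ *ᵥ 1) := by
        rw [pow_two, ← mulVec_mulVec, dotProduct_mulVec]
    _ = ∑ w, (G.degree w : ℝ) ^ 2 := by
        simp [dotProduct, SimpleGraph.adjMatrix_mulVec_apply, pow_two]

theorem spectralMoment_four (hG : G.IsAcyclic) :
    spectralMoment G 4 = 2 * ∑ v, (G.degree v : ℝ) ^ 2 - ∑ v, (G.degree v : ℝ) := by
  classical
  have sq_entry (u v : V) : (G.adjMatrix ℝ ^ 2) u v * (G.adjMatrix ℝ ^ 2) v u =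
      (G.adjMatrix ℝ ^ 2) u v + if u = v then (G.degree u : ℝ) ^ 2 - G.degree u else 0 := by
    split_ifs with huv
    · rw [← huv, adjMatrix_sq_apply_self]
      ring
    · rw [adjMatrix_sq_apply, adjMatrix_sq_apply, Finset.inter_comm (G.neighborFinset v)]
      have := card_neighborFinset_inter_le_one hG huv
      interval_cases #(G.neighborFinset u ∩ G.neighborFinset v) <;> simp
  calc spectralMoment G 4
      = ∑ u, ∑ v, (G.adjMatrix ℝ ^ 2) u v * (G.adjMatrix ℝ ^ 2) v u := by
        rw [spectralMoment_eq_trace, show 4 = 2 + 2 from rfl, pow_add]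
        simp only [Matrix.trace, diag_apply, Matrix.mul_apply]
    _ = _ := by
        simp only [sq_entry, Finset.sum_add_distrib, sum_adjMatrix_sq, Finset.sum_ite_eq,
          Finset.mem_univ, if_true, Finset.sum_sub_distrib]
        ring

end Codegree

section Excess

variable {V W : Type*}

/-- The excess of a vertex is its degree minus one. In a nontrivial tree, where degrees are
positive, the excesses on one side of the bipartition sum up to the size of the other side minus
one. -/
noncomputable def excess (G : SimpleGraph V) (v : V) : ℕ := (G.neighborSet v).ncard - 1

theorem excess_eq_degree_sub_one (G : SimpleGraph V) (v : V) [Fintype (G.neighborSet v)] :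
    excess G v = G.degree v - 1 := by
  rw [excess, Set.ncard_eq_toFinset_card', ← SimpleGraph.card_neighborFinset_eq_degree]
  rfl

theorem degree_eq_excess_add_one [Nontrivial V] {G : SimpleGraph V} (hG : G.Preconnected) (v : V)
    [Fintype (G.neighborSet v)] : G.degree v = excess G v + 1 := by
  have := hG.degree_pos_of_nontrivial v
  rw [excess_eq_degree_sub_one]
  omega

variable [Fintype V] [Fintype W] {G : SimpleGraph V} {H : SimpleGraph W}

theorem sum_degree_of_isTree (hG : G.IsTree) [DecidableRel G.Adj] :
    ∑ v, (G.degree v : ℝ) = 2 * (Fintype.card V - 1) := by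
  rw [← hG.card_edgeFinset, Nat.cast_add, Nat.cast_one, add_sub_cancel_right]
  exact_mod_cast G.sum_degrees_eq_twice_card_edges

theorem spectralMoment_two_of_isTree (hG : G.IsTree) :
    spectralMoment G 2 = 2 * (Fintype.card V - 1) := by
  classical rw [spectralMoment_two, sum_degree_of_isTree hG]

theorem spectralMoment_four_of_isTree [Nontrivial V] (hG : G.IsTree) :
    spectralMoment G 4 = 2 * ∑ v, (excess G v : ℝ) ^ 2 + 4 * Fintype.card V - 6 := by
  classical
  have degree_sq (v : V) : (G.degree v : ℝ) ^ 2 = excess G v ^ 2 + 2 * G.degree v - 1 := by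
    rw [degree_eq_excess_add_one hG.connected.preconnected]
    push_cast
    ring
  simp only [spectralMoment_four hG.isAcyclic, degree_sq, Finset.sum_sub_distrib,
    Finset.sum_add_distrib, ← Finset.mul_sum, sum_degree_of_isTree hG, Finset.sum_const,
    Finset.card_univ, nsmul_eq_mul]
  ring

theorem spectralMoment_eq_of_lt_four (hG : G.IsTree) (hH : H.IsTree)
    (card_eq : Fintype.card V = Fintype.card W) {i : ℕ} (hi : i < 4) :
    spectralMoment G i = spectralMoment H i := by
  have eq_of_odd (hi : Odd i) : spectralMoment G i = spectralMoment H i := by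
    rw [spectralMoment_eq_zero_of_odd hG.isBipartite hi,
      spectralMoment_eq_zero_of_odd hH.isBipartite hi]
  interval_cases i
  · rw [spectralMoment_zero, spectralMoment_zero, card_eq]
  · exact eq_of_odd odd_one
  · rw [spectralMoment_two_of_isTree hG, spectralMoment_two_of_isTree hH, card_eq]
  · exact eq_of_odd (by decide)

theorem sBefore_of_sum_excess_sq_lt (hG : G.IsTree) (hH : H.IsTree)
    (card_eq : Fintype.card V = Fintype.card W) (card_lt : 4 < Fintype.card V)
    (h : ∑ v, excess G v ^ 2 < ∑ v, excess H v ^ 2) : SBefore G H := by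
  have : Nontrivial V := Fintype.one_lt_card_iff_nontrivial.1 (by omega)
  have : Nontrivial W := Fintype.one_lt_card_iff_nontrivial.1 (by omega)
  refine ⟨4, by omega, card_lt, fun i hi => spectralMoment_eq_of_lt_four hG hH card_eq hi, ?_⟩
  rw [spectralMoment_four_of_isTree hG, spectralMoment_four_of_isTree hH, card_eq]
  have : ∑ v, (excess G v : ℝ) ^ 2 < ∑ v, (excess H v : ℝ) ^ 2 := by exact_mod_cast h
  linarith

theorem spectralMoment_eq_of_lt_six (hG : G.IsTree) (hH : H.IsTree) [Nontrivial V]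
    (card_eq : Fintype.card V = Fintype.card W)
    (h : ∑ v, excess G v ^ 2 = ∑ v, excess H v ^ 2) {i : ℕ} (hi : i < 6) :
    spectralMoment G i = spectralMoment H i := by
  obtain hi | rfl | rfl : i < 4 ∨ i = 4 ∨ i = 5 := by omega
  · exact spectralMoment_eq_of_lt_four hG hH card_eq hi
  · have : Nontrivial W := Fintype.one_lt_card_iff_nontrivial.1 (card_eq ▸ Fintype.one_lt_card)
    have : ∑ v, (excess G v : ℝ) ^ 2 = ∑ v, (excess H v : ℝ) ^ 2 := by exact_mod_cast h
    rw [spectralMoment_four_of_isTree hG, spectralMoment_four_of_isTree hH, card_eq, this]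
  · rw [spectralMoment_eq_zero_of_odd hG.isBipartite (by decide),
      spectralMoment_eq_zero_of_odd hH.isBipartite (by decide)]

theorem SBefore.trans {U : Type*} [Fintype U] {F : SimpleGraph U} (hFG : SBefore F G)
    (hGH : SBefore G H) : SBefore F H := by
  obtain ⟨k, hk, hkU, eq_k, lt_k⟩ := hFG
  obtain ⟨l, hl, hlV, eq_l, lt_l⟩ := hGH
  have card_eq : Fintype.card U = Fintype.card V := by
    exact_mod_cast spectralMoment_zero F ▸ spectralMoment_zero G ▸ eq_k 0 hk
  refine ⟨min k l, le_min hk hl, by omega,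
    fun i hi => (eq_k i (by omega)).trans (eq_l i (by omega)), ?_⟩
  obtain hkl | rfl | hlk := lt_trichotomy k l
  · rw [min_eq_left hkl.le]
    exact lt_k.trans_eq (eq_l k hkl)
  · rw [min_self]
    exact lt_k.trans lt_l
  · rw [min_eq_right hlk.le]
    exact (eq_k l hlk).trans_lt lt_l

end Excess

section Bipartition

variable {V W : Type*} {G : SimpleGraph V} {H : SimpleGraph W} {s t : Finset V} {s' t' : Finset W}

/-- A bipartition of `G` into the classes `s` and `t`: unlike `G.IsBipartiteWith s t` alone, it
leaves no vertex unclassified. -/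
structure IsBipartition (G : SimpleGraph V) (s t : Finset V) : Prop
    extends G.IsBipartiteWith s t where
  mem_or_mem : ∀ v, v ∈ s ∨ v ∈ t

namespace IsBipartition

theorem symm (h : IsBipartition G s t) : IsBipartition G t s :=
  ⟨h.toIsBipartiteWith.symm, fun v => (h.mem_or_mem v).symm⟩

theorem notMem_right (h : IsBipartition G s t) {v : V} (hv : v ∈ s) : v ∉ t :=
  Finset.disjoint_left.1 (Finset.disjoint_coe.1 h.disjoint) hv

theorem mem_right_of_adj (h : IsBipartition G s t) {u v : V} (hu : u ∈ s) (huv : G.Adj u v) :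
    v ∈ t :=
  h.toIsBipartiteWith.mem_of_mem_adj hu huv

theorem not_adj_of_mem_left (h : IsBipartition G s t) {u v : V} (hu : u ∈ s) (hv : v ∈ s) :
    ¬ G.Adj u v := fun huv => h.notMem_right hv (h.mem_right_of_adj hu huv)

/-- The vertices of a bipartite graph, split into the two classes. -/
noncomputable def partsEquiv (h : IsBipartition G s t) : s ⊕ t ≃ V :=
  Equiv.ofBijective (Sum.elim (↑) (↑)) <| by
    refine ⟨Subtype.val_injective.sumElim Subtype.val_injective ?_, fun v => ?_⟩
    · exact fun u v huv => h.notMem_right u.2 (huv ▸ v.2)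
    · exact (h.mem_or_mem v).elim (fun hv => ⟨.inl ⟨v, hv⟩, rfl⟩) fun hv => ⟨.inr ⟨v, hv⟩, rfl⟩

@[simp]
theorem partsEquiv_inl (h : IsBipartition G s t) (u : s) : h.partsEquiv (.inl u) = u := rfl

@[simp]
theorem partsEquiv_inr (h : IsBipartition G s t) (v : t) : h.partsEquiv (.inr v) = v := rfl

theorem nonempty_iso (hG : IsBipartition G s t) (hH : IsBipartition H s' t') (α : s ≃ s')
    (β : t ≃ t') (adj_iff : ∀ u v, H.Adj (α u) (β v) ↔ G.Adj u v) : Nonempty (G ≃g H) := by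
  have adj_parts (a b : s ⊕ t) :
      H.Adj (hH.partsEquiv (α.sumCongr β a)) (hH.partsEquiv (α.sumCongr β b)) ↔
        G.Adj (hG.partsEquiv a) (hG.partsEquiv b) := by
    rcases a with u | v <;> rcases b with u' | v' <;>
      simp only [Equiv.sumCongr_apply, Sum.map_inl, Sum.map_inr, partsEquiv_inl, partsEquiv_inr]
    · exact iff_of_false (hH.not_adj_of_mem_left (α u).2 (α u').2)
        (hG.not_adj_of_mem_left u.2 u'.2)
    · exact adj_iff u v'
    · rw [H.adj_comm, G.adj_comm, adj_iff]
    · exact iff_of_false (hH.symm.not_adj_of_mem_left (β v).2 (β v').2)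
        (hG.symm.not_adj_of_mem_left v.2 v'.2)
  exact ⟨(hG.partsEquiv.symm.trans (α.sumCongr β)).trans hH.partsEquiv,
    fun {a b} => by simpa using adj_parts (hG.partsEquiv.symm a) (hG.partsEquiv.symm b)⟩

theorem sum_univ [Fintype V] {M : Type*} [AddCommMonoid M] (h : IsBipartition G s t) (f : V → M) :
    ∑ v, f v = ∑ v ∈ s, f v + ∑ v ∈ t, f v := by
  rw [← h.partsEquiv.sum_comp f, Fintype.sum_sum_type, ← Finset.sum_coe_sort s,
    ← Finset.sum_coe_sort t]
  rfl

theorem card_add_card [Fintype V] (h : IsBipartition G s t) : #s + #t = Fintype.card V := by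
  simpa using Fintype.card_congr h.partsEquiv

/-- Closed walks of even length are evenly split between the two classes. -/
theorem spectralMoment_two_mul [Fintype V] [DecidableEq V] [DecidableRel G.Adj]
    (h : IsBipartition G s t) {k : ℕ} (hk : k ≠ 0) : spectralMoment G (2 * k) =
      2 * (((G.adjMatrix ℝ ^ 2).submatrix (↑) (↑) : Matrix t t ℝ) ^ k).trace := by
  let A := G.adjMatrix ℝ
  let B : Matrix s t ℝ := A.submatrix (↑) (↑)
  let e := h.partsEquiv
  have submatrix_pow (j : ℕ) : (A ^ j).submatrix e e = A.submatrix e e ^ j :=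
    map_pow (reindexRingEquiv ℝ e.symm) A j
  have blocks : A.submatrix e e = fromBlocks 0 B Bᵀ 0 := by
    ext (u | v) (u' | v')
    · simp [A, e, h.not_adj_of_mem_left]
    · rfl
    · simp [A, B, e, G.adj_comm v]
    · simp [A, e, h.symm.not_adj_of_mem_left]
  have sq_blocks : A.submatrix e e ^ 2 = fromBlocks (B * Bᵀ) 0 0 (Bᵀ * B) := by
    simp [blocks, pow_two, fromBlocks_multiply]
  have sq_right : ((A ^ 2).submatrix (↑) (↑) : Matrix t t ℝ) = Bᵀ * B :=
    congrArg toBlocks₂₂ ((submatrix_pow 2).trans sq_blocks)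
  calc spectralMoment G (2 * k)
      = (A.submatrix e e ^ (2 * k)).trace := by
        rw [spectralMoment_eq_trace, ← submatrix_pow]
        exact (e.sum_comp _).symm
    _ = ((B * Bᵀ) ^ k).trace + ((Bᵀ * B) ^ k).trace := by
        rw [pow_mul, sq_blocks, fromBlocks_diagonal_pow, Matrix.trace, Fintype.sum_sum_type]
        rfl
    _ = _ := by rw [trace_mul_pow_comm _ _ hk, sq_right, two_mul]

theorem sum_excess_left [Nontrivial V] (h : IsBipartition G s t) (hG : G.IsTree) :
    ∑ v ∈ s, excess G v = #t - 1 := by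
  classical
  have := Fintype.ofEquiv _ h.partsEquiv
  have sum_degree : ∑ v ∈ s, (excess G v + 1) = #s + #t - 1 := by
    rw [h.card_add_card, ← hG.card_edgeFinset, Nat.add_sub_cancel,
      ← SimpleGraph.isBipartiteWith_sum_degrees_eq_card_edges h.toIsBipartiteWith]
    exact Finset.sum_congr rfl fun v _ =>
      (degree_eq_excess_add_one hG.connected.preconnected v).symm
  rw [Finset.sum_add_distrib, Finset.sum_const, smul_eq_mul, mul_one] at sum_degree
  omega

end IsBipartition

end Bipartition

section PowerSums

/-- The `n`-th power sum of a partition, given by the multiset of its parts. -/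
def powerSum (P : Multiset ℕ) (n : ℕ) : ℕ := (P.map (· ^ n)).sum

@[simp]
theorem powerSum_zero (n : ℕ) : powerSum 0 n = 0 := rfl

@[simp]
theorem powerSum_cons (a : ℕ) (P : Multiset ℕ) (n : ℕ) :
    powerSum (a ::ₘ P) n = a ^ n + powerSum P n := by
  simp [powerSum]

@[simp]
theorem powerSum_singleton (a n : ℕ) : powerSum {a} n = a ^ n := by
  simp [powerSum]

theorem powerSum_one (P : Multiset ℕ) : powerSum P 1 = P.sum := by
  simp [powerSum]

theorem powerSum_filter_ne_zero (P : Multiset ℕ) {n : ℕ} (hn : n ≠ 0) :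
    powerSum (P.filter (· ≠ 0)) n = powerSum P n := by
  induction P using Multiset.induction_on with
  | empty => rfl
  | cons a P ih => by_cases ha : a = 0 <;> simp [ha, hn, ih]

theorem powerSum_le_sum_pow (P : Multiset ℕ) {n : ℕ} (hn : n ≠ 0) : powerSum P n ≤ P.sum ^ n := by
  induction P using Multiset.induction_on with
  | empty => simp
  | cons a P ih =>
    rw [powerSum_cons, Multiset.sum_cons]
    exact (Nat.add_le_add_left ih _).trans (pow_add_pow_le a.zero_le P.sum.zero_le hn)

theorem powerSum_succ_le_mul {P : Multiset ℕ} {a : ℕ} (h : ∀ b ∈ P, b ≤ a) (n : ℕ) :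
    powerSum P (n + 1) ≤ a * powerSum P n := by
  rw [powerSum, powerSum, ← Multiset.sum_map_mul_left]
  exact Multiset.sum_map_le_sum_map _ _ fun b hb =>
    (pow_succ' b n).trans_le (Nat.mul_le_mul_right _ (h b hb))

theorem powerSum_two_le_of_forall_lt_sum {P : Multiset ℕ} (h : ∀ a ∈ P, a < P.sum) :
    powerSum P 2 ≤ (P.sum - 1) ^ 2 + 1 := by
  by_cases sum_eq : P.sum = 0
  · have := powerSum_le_sum_pow P two_ne_zero
    simp only [sum_eq] at this ⊢
    omega
  obtain ⟨a, ha, ha0⟩ : ∃ a ∈ P, a ≠ 0 := by simpa [Multiset.sum_eq_zero_iff] using sum_eq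
  have a_lt := h a ha
  obtain ⟨Q, rfl⟩ := Multiset.exists_cons_of_mem ha
  rw [Multiset.sum_cons] at a_lt ⊢
  obtain ⟨b, rfl⟩ := Nat.exists_eq_succ_of_ne_zero ha0
  obtain ⟨r, hr⟩ := Nat.exists_eq_add_one_of_ne_zero (show Q.sum ≠ 0 by omega)
  calc powerSum ((b + 1) ::ₘ Q) 2
      ≤ (b + 1) ^ 2 + (r + 1) ^ 2 := by
        rw [powerSum_cons]
        exact Nat.add_le_add_left (hr ▸ powerSum_le_sum_pow Q two_ne_zero) _
    _ ≤ (b + 1 + Q.sum - 1) ^ 2 + 1 := by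
        rw [hr, show b + 1 + (r + 1) - 1 = b + r + 1 by omega]
        nlinarith [Nat.zero_le (b * r)]

/-- The lexicographic comparison of the second and third power sums. The `S`-order on trees with a
vertex adjacent to a whole class compares the partitions formed by the excesses in this way. -/
def PowerSumLT (P Q : Multiset ℕ) : Prop :=
  powerSum P 2 < powerSum Q 2 ∨ powerSum P 2 = powerSum Q 2 ∧ powerSum P 3 < powerSum Q 3

theorem eq_zero_of_sum_eq_zero {P : Multiset ℕ} (pos : 0 ∉ P) (h : P.sum = 0) : P = 0 :=
  Multiset.eq_zero_of_forall_notMem fun a ha => pos (Multiset.sum_eq_zero_iff.1 h a ha ▸ ha)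

theorem partition_of_sum_le_two {P : Multiset ℕ} (pos : 0 ∉ P) (h : P.sum ≤ 2) :
    P = 0 ∨ P = {1} ∨ P = {2} ∨ P = {1, 1} := by
  obtain rfl | ⟨a, ha⟩ := P.empty_or_exists_mem
  · exact .inl rfl
  obtain ⟨Q, rfl⟩ := Multiset.exists_cons_of_mem ha
  rw [Multiset.mem_cons, not_or] at pos
  rw [Multiset.sum_cons] at h
  obtain ⟨rfl, hQ⟩ | ⟨rfl, hQ⟩ | ⟨rfl, hQ⟩ :
      a = 1 ∧ Q.sum = 0 ∨ a = 2 ∧ Q.sum = 0 ∨ a = 1 ∧ Q.sum = 1 := by omega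
  · simp [eq_zero_of_sum_eq_zero pos.2 hQ]
  · simp [eq_zero_of_sum_eq_zero pos.2 hQ]
  · obtain ⟨b, hb⟩ := Multiset.exists_mem_of_ne_zero (s := Q) (by rintro rfl; simp at hQ)
    obtain ⟨R, rfl⟩ := Multiset.exists_cons_of_mem hb
    rw [Multiset.mem_cons, not_or] at pos
    rw [Multiset.sum_cons] at hQ
    have := eq_zero_of_sum_eq_zero pos.2.2 (by omega)
    obtain rfl : b = 1 := by omega
    simp [this]

/-- The only tie of second power sums is `3² + 3² = 4² + 1² + 1²`, broken by the third ones. -/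
theorem powerSumLT_of_three_le_sum {a : ℕ} {Q : Multiset ℕ} (ha : a ≠ 0) (le_a : ∀ b ∈ Q, b ≤ a)
    (hQ : 3 ≤ Q.sum) : PowerSumLT (a ::ₘ Q) {a + Q.sum - 2, 1, 1} := by
  have sq_le := powerSum_le_sum_pow Q two_ne_zero
  have cube_le := powerSum_le_sum_pow Q three_ne_zero
  have sq_le_mul : powerSum Q 2 ≤ a * Q.sum := powerSum_one Q ▸ powerSum_succ_le_mul le_a 1
  simp only [PowerSumLT, Multiset.insert_eq_cons, powerSum_cons, powerSum_singleton, one_pow]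
  generalize Q.sum = r at *
  obtain ⟨r, rfl⟩ := Nat.exists_eq_add_of_le hQ
  rw [show a + (3 + r) - 2 = a + r + 1 by omega]
  obtain rfl | rfl | ha : a = 1 ∨ a = 2 ∨ 3 ≤ a := by omega
  · left; nlinarith
  · left; nlinarith
  obtain ⟨b, rfl⟩ := Nat.exists_eq_add_of_le ha
  by_cases h : b = 0 ∧ r = 0
  · obtain ⟨rfl, rfl⟩ := h
    omega
  · left
    have : 0 < b + r := by omega
    nlinarith [Nat.zero_le (b * r)]

theorem partition_eq_or_powerSumLT {P : Multiset ℕ} (pos : 0 ∉ P) (hP : 3 ≤ P.sum) :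
    P = {P.sum} ∨ P = {P.sum - 1, 1} ∨ P = {P.sum - 2, 2} ∨ P = {P.sum - 2, 1, 1} ∨
      PowerSumLT P {P.sum - 2, 1, 1} := by
  obtain ⟨a, ha, le_a⟩ := Multiset.exists_max_image id (s := P) (by rintro rfl; simp at hP)
  obtain ⟨Q, rfl⟩ := Multiset.exists_cons_of_mem ha
  rw [Multiset.mem_cons, not_or] at pos
  rw [Multiset.sum_cons]
  obtain hQ | hQ := le_or_gt Q.sum 2
  · obtain rfl | rfl | rfl | rfl := partition_of_sum_le_two pos.2 hQ <;> simp
  · exact .inr <| .inr <| .inr <| .inr <| powerSumLT_of_three_le_sum (Ne.symm pos.1)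
      (fun b hb => le_a b (Multiset.mem_cons_of_mem hb)) hQ

end PowerSums

section ExcessParts

variable {V : Type*} (G : SimpleGraph V) (t : Finset V)

/-- The partition formed by the nonzero excesses of the vertices in `t`. -/
noncomputable def excessParts : Multiset ℕ := (t.val.map (excess G)).filter (· ≠ 0)

theorem zero_notMem_excessParts : 0 ∉ excessParts G t := by simp [excessParts]

theorem powerSum_excessParts {n : ℕ} (hn : n ≠ 0) :
    powerSum (excessParts G t) n = ∑ v ∈ t, excess G v ^ n := by
  rw [excessParts, powerSum_filter_ne_zero _ hn, powerSum, Multiset.map_map]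
  rfl

theorem sum_excessParts : (excessParts G t).sum = ∑ v ∈ t, excess G v := by
  simpa [powerSum_one] using powerSum_excessParts G t one_ne_zero

theorem sum_sq_excess_le [Nontrivial V] {G : SimpleGraph V} {s t : Finset V} (hG : G.IsTree)
    (h : IsBipartition G s t) (excess_lt : ∀ v ∈ s, excess G v < #t - 1) :
    ∑ v ∈ s, excess G v ^ 2 ≤ (#t - 2) ^ 2 + 1 := by
  have sum_eq : (excessParts G s).sum = #t - 1 := by rw [sum_excessParts, h.sum_excess_left hG]
  have le := powerSum_two_le_of_forall_lt_sum (P := excessParts G s) fun a ha => by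
    simp only [excessParts, Multiset.mem_filter, Multiset.mem_map, Finset.mem_val] at ha
    obtain ⟨⟨v, hv, rfl⟩, -⟩ := ha
    exact sum_eq ▸ excess_lt v hv
  rwa [sum_eq, powerSum_excessParts G s two_ne_zero] at le

variable {G t}

theorem map_excess_eq_of_excessParts_eq {W : Type*} {H : SimpleGraph W} {t' : Finset W}
    (card_eq : #t = #t') (h : excessParts G t = excessParts H t') :
    t.val.map (excess G) = t'.val.map (excess H) := by
  have eq_add_replicate (M : Multiset ℕ) : M =
      M.filter (· ≠ 0) + Multiset.replicate (M.card - (M.filter (· ≠ 0)).card) 0 := by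
    conv_lhs => rw [← Multiset.filter_add_not (· ≠ 0) M]
    congr 1
    refine Multiset.eq_replicate.2 ⟨?_, by simp⟩
    rw [← Multiset.card_sub (Multiset.filter_le _ _), Multiset.sub_filter_eq_filter_not]
  rw [eq_add_replicate (t.val.map _), eq_add_replicate (t'.val.map _)]
  rw [excessParts, excessParts] at h
  simp only [h, Multiset.card_map, Finset.card_val, card_eq]

end ExcessParts

section Fibers

theorem exists_equiv_of_card_fiber_eq {α β γ : Type*} [Finite α] [Finite β] {f : α → γ} {g : β → γ}
    (h : ∀ c, Nat.card {a // f a = c} = Nat.card {b // g b = c}) :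
    ∃ σ : α ≃ β, ∀ a, g (σ a) = f a :=
  ⟨Equiv.ofFiberEquiv fun c => (Finite.card_eq.1 (h c)).some, Equiv.ofFiberEquiv_map _⟩

theorem natCard_fiber_eq_count {α γ : Type*} [DecidableEq γ] (s : Finset α) (f : α → γ) (c : γ) :
    Nat.card {a : s // f a = c} = (s.val.map f).count c := by
  rw [Nat.card_congr (Equiv.subtypeSubtypeEquivSubtypeInter (· ∈ s) (f · = c)),
    Nat.subtype_card {a ∈ s | c = f a} fun a => by simp [eq_comm], Multiset.count_map]
  rfl

theorem exists_equiv_of_map_eq {α β γ : Type*} {s : Finset α} {t : Finset β} {f : α → γ}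
    {g : β → γ} (h : s.val.map f = t.val.map g) : ∃ σ : s ≃ t, ∀ a, g (σ a) = f a := by
  classical
  exact exists_equiv_of_card_fiber_eq (f := fun a : s => f a) (g := fun b : t => g b) fun c => by
    rw [natCard_fiber_eq_count, natCard_fiber_eq_count, h]

end Fibers

section HubTree

variable {V W : Type*} {G : SimpleGraph V} {H : SimpleGraph W} {s t : Finset V} {s' t' : Finset W}
  {x : V} {x' : W}

/-- A tree with bipartition `(s, t)` whose vertex `x ∈ s`, the hub, is adjacent to all of `t`. The
other vertices in `s` are then leaves, so that up to isomorphism the tree is given by the numbers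
of leaves hanging on the vertices of `t`, which are their excesses. -/
structure IsHubTree (G : SimpleGraph V) (s t : Finset V) (x : V) : Prop
    extends IsBipartition G s t where
  isTree : G.IsTree
  hub_mem : x ∈ s
  adj_hub : ∀ v ∈ t, G.Adj x v

theorem IsBipartition.isHubTree (h : IsBipartition G s t) (hub_mem : x ∈ s)
    (adj_hub : ∀ v ∈ t, G.Adj x v) (pendant : ∀ y ∈ s, y ≠ x → ∃! v, G.Adj y v) :
    IsHubTree G s t x := by
  classical
  have := Fintype.ofEquiv _ h.partsEquiv
  have reachable_right (v) (hv : v ∈ t) : G.Reachable x v := (adj_hub v hv).reachable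
  have connected : G.Connected := by
    refine (SimpleGraph.connected_iff_exists_forall_reachable _).2 ⟨x, fun v => ?_⟩
    obtain hv | hv := h.mem_or_mem v
    · obtain rfl | hvx := eq_or_ne v x
      · rfl
      · obtain ⟨w, hw, -⟩ := pendant v hv hvx
        exact (reachable_right w (h.mem_right_of_adj hv hw)).trans hw.symm.reachable
    · exact reachable_right v hv
  have degree_hub : G.degree x = #t := by
    rw [← SimpleGraph.card_neighborFinset_eq_degree]
    congr 1
    ext v
    rw [SimpleGraph.mem_neighborFinset]
    exact ⟨h.mem_right_of_adj hub_mem, adj_hub v⟩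
  have card_edges : #G.edgeFinset = #t + (#s - 1) := by
    rw [← SimpleGraph.isBipartiteWith_sum_degrees_eq_card_edges h.toIsBipartiteWith,
      ← Finset.add_sum_erase _ _ hub_mem, degree_hub, ← Finset.card_erase_of_mem hub_mem,
      Finset.card_eq_sum_ones (s.erase x), Finset.sum_congr rfl]
    exact fun y hy => SimpleGraph.degree_eq_one_iff_existsUnique_adj.2
      (pendant y (Finset.mem_of_mem_erase hy) (Finset.ne_of_mem_erase hy))
  have card_left_pos : 0 < #s := Finset.card_pos.2 ⟨x, hub_mem⟩
  refine ⟨h, SimpleGraph.isTree_iff_connected_and_card.2 ⟨connected, ?_⟩, hub_mem, adj_hub⟩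
  rw [Nat.card_eq_fintype_card, ← SimpleGraph.edgeFinset_card, card_edges,
    Nat.card_eq_fintype_card, ← h.card_add_card]
  omega

theorem IsBipartition.excess_lt_or_isHubTree [Nontrivial V] (h : IsBipartition G s t)
    (hG : G.IsTree) (hx : x ∈ s) : excess G x < #t - 1 ∨ IsHubTree G s t x := by
  classical
  have := Fintype.ofEquiv _ h.partsEquiv
  have subset : G.neighborFinset x ⊆ t := fun v hv =>
    h.mem_right_of_adj hx ((G.mem_neighborFinset x v).1 hv)
  obtain eq | ssubset := subset.eq_or_ssubset
  · exact .inr ⟨h, hG, hx, fun v hv => (G.mem_neighborFinset x v).1 (eq ▸ hv)⟩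
  · have card_lt := Finset.card_lt_card ssubset
    rw [SimpleGraph.card_neighborFinset_eq_degree,
      degree_eq_excess_add_one hG.connected.preconnected] at card_lt
    exact .inl (Nat.lt_sub_of_add_lt card_lt)

namespace IsHubTree

theorem neighborSet_hub (h : IsHubTree G s t x) : G.neighborSet x = t :=
  Set.ext fun v => ⟨h.mem_right_of_adj h.hub_mem, h.adj_hub v⟩

theorem excess_hub (h : IsHubTree G s t x) : excess G x = #t - 1 := by
  rw [excess, h.neighborSet_hub, Set.ncard_coe_finset]

theorem excess_eq_zero [Nontrivial V] (h : IsHubTree G s t x) {y : V} (hy : y ∈ s) (hyx : y ≠ x) :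
    excess G y = 0 := by
  classical
  have sum_eq := h.sum_excess_left h.isTree
  rw [← Finset.add_sum_erase _ _ h.hub_mem, h.excess_hub, Nat.add_eq_left,
    Finset.sum_eq_zero_iff] at sum_eq
  exact sum_eq y (Finset.mem_erase.2 ⟨hyx, hy⟩)

theorem existsUnique_adj [Nontrivial V] (h : IsHubTree G s t x) {y : V} (hy : y ∈ s)
    (hyx : y ≠ x) : ∃! v, G.Adj y v := by
  classical
  have := Fintype.ofEquiv _ h.partsEquiv
  rw [← SimpleGraph.degree_eq_one_iff_existsUnique_adj,
    degree_eq_excess_add_one h.isTree.connected.preconnected, h.excess_eq_zero hy hyx]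

theorem sum_sq_excess [Nontrivial V] [Fintype V] (h : IsHubTree G s t x) :
    ∑ v, excess G v ^ 2 = (#t - 1) ^ 2 + powerSum (excessParts G t) 2 := by
  rw [h.sum_univ, powerSum_excessParts G t two_ne_zero, Finset.sum_eq_single_of_mem x h.hub_mem,
    h.excess_hub]
  intro y hy hyx
  rw [h.excess_eq_zero hy hyx, zero_pow two_ne_zero]

theorem spectralMoment_six [Nontrivial V] [Fintype V] (h : IsHubTree G s t x) :
    spectralMoment G 6 = 2 * (#t ^ 3 + 3 * #t * ∑ v ∈ t, (excess G v : ℝ) +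
      3 * ∑ v ∈ t, (excess G v : ℝ) ^ 2 + ∑ v ∈ t, (excess G v : ℝ) ^ 3) := by
  classical
  have sq_eq : ((G.adjMatrix ℝ ^ 2).submatrix (↑) (↑) : Matrix t t ℝ) =
      of (fun _ _ => 1) + diagonal fun v : t => (excess G v : ℝ) := by
    ext u v
    obtain rfl | huv := eq_or_ne u v
    · simp [adjMatrix_sq_apply_self, degree_eq_excess_add_one h.isTree.connected.preconnected,
        add_comm]
    · have card_le := card_neighborFinset_inter_le_one h.isTree.isAcyclic
        (Subtype.coe_injective.ne huv)
      have card_pos : 0 < #(G.neighborFinset u ∩ G.neighborFinset v) :=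
        Finset.card_pos.2 ⟨x, by simp [(h.adj_hub _ u.2).symm, (h.adj_hub _ v.2).symm]⟩
      simp [adjMatrix_sq_apply, huv, show #(G.neighborFinset u ∩ G.neighborFinset v) = 1 by omega]
  rw [show 6 = 2 * 3 from rfl, h.spectralMoment_two_mul three_ne_zero, sq_eq,
    trace_ones_add_diagonal_pow_three, Fintype.card_coe,
    Finset.sum_coe_sort t fun v => (excess G v : ℝ),
    Finset.sum_coe_sort t fun v => (excess G v : ℝ) ^ 2,
    Finset.sum_coe_sort t fun v => (excess G v : ℝ) ^ 3]

/-- If the second power sums agree, the first difference is in the sixth moments. -/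
theorem sBefore_of_powerSumLT [Fintype V] [Fintype W] (hG : IsHubTree G s t x)
    (hH : IsHubTree H s' t' x') (card_left : #s = #s') (card_right : #t = #t')
    (card_lt : 6 < Fintype.card V) (h : PowerSumLT (excessParts G t) (excessParts H t')) :
    SBefore G H := by
  have card_eq : Fintype.card V = Fintype.card W := by
    rw [← hG.card_add_card, ← hH.card_add_card, card_left, card_right]
  have : Nontrivial V := Fintype.one_lt_card_iff_nontrivial.1 (by omega)
  have : Nontrivial W := Fintype.one_lt_card_iff_nontrivial.1 (by omega)
  obtain h | ⟨sq_eq, cube_lt⟩ := h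
  · refine sBefore_of_sum_excess_sq_lt hG.isTree hH.isTree card_eq (by omega) ?_
    rw [hG.sum_sq_excess, hH.sum_sq_excess, card_right]
    exact Nat.add_lt_add_left h _
  refine ⟨6, by omega, card_lt, fun i hi =>
    spectralMoment_eq_of_lt_six hG.isTree hH.isTree card_eq ?_ hi, ?_⟩
  · rw [hG.sum_sq_excess, hH.sum_sq_excess, card_right, sq_eq]
  · have sum_eq : ∑ v ∈ t, excess G v = ∑ v ∈ t', excess H v := by
      rw [hG.symm.sum_excess_left hG.isTree, hH.symm.sum_excess_left hH.isTree, card_left]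
    rw [powerSum_excessParts _ _ two_ne_zero, powerSum_excessParts _ _ two_ne_zero] at sq_eq
    rw [powerSum_excessParts _ _ three_ne_zero, powerSum_excessParts _ _ three_ne_zero] at cube_lt
    rw [hG.spectralMoment_six, hH.spectralMoment_six, card_right]
    exact_mod_cast (by rw [sum_eq, sq_eq]; omega)

/-- The hub has no parent; every other vertex in `s` hangs on its parent in `t`. -/
theorem exists_parent [Nontrivial V] (h : IsHubTree G s t x) : ∃ parent : s → Option t,
    (∀ (y : s) (b : t), G.Adj y b ↔ parent y = none ∨ parent y = some b) ∧
    Nat.card {y // parent y = none} = 1 ∧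
    ∀ b : t, Nat.card {y // parent y = some b} = excess G b := by
  have exists_parent_of_mem (y : s) : ∃ o : Option t,
      (∀ b : t, G.Adj y b ↔ o = none ∨ o = some b) ∧ (o = none ↔ (y : V) = x) := by
    obtain hyx | hyx := eq_or_ne (y : V) x
    · exact ⟨none, by simp [hyx, h.adj_hub], by simp [hyx]⟩
    · obtain ⟨b, hb, unique⟩ := h.existsUnique_adj y.2 hyx
      refine ⟨some ⟨b, h.mem_right_of_adj y.2 hb⟩, fun c => ?_, by simp [hyx]⟩
      simp only [reduceCtorEq, false_or, Option.some_inj, Subtype.ext_iff]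
      exact ⟨fun hc => (unique c hc).symm, fun hc => hc ▸ hb⟩
  choose parent adj_iff eq_none_iff using exists_parent_of_mem
  refine ⟨parent, adj_iff, ?_, fun b => ?_⟩
  · simp only [eq_none_iff]
    exact Nat.card_eq_one_iff_exists.2
      ⟨⟨⟨x, h.hub_mem⟩, rfl⟩, fun y => Subtype.ext (Subtype.ext y.2)⟩
  · have neighborSet_eq : G.neighborSet b = insert x ((↑) '' {y | parent y = some b}) := by
      ext v
      rw [Set.mem_insert_iff, SimpleGraph.mem_neighborSet, G.adj_comm]
      constructor
      · intro hv
        have hvs := h.symm.mem_right_of_adj b.2 hv.symm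
        exact ((adj_iff ⟨v, hvs⟩ b).1 hv).imp (eq_none_iff _).1 fun hv => ⟨_, hv, rfl⟩
      · rintro (rfl | ⟨y, hy, rfl⟩)
        · exact h.adj_hub b b.2
        · exact (adj_iff y b).2 (.inr hy)
    have notMem : x ∉ (↑) '' {y | parent y = some b} := by
      rintro ⟨y, hy, hyx⟩
      exact Option.some_ne_none b (hy.symm.trans ((eq_none_iff y).2 hyx))
    rw [excess, neighborSet_eq, Set.ncard_insert_of_notMem notMem, Nat.add_sub_cancel,
      Set.ncard_image_of_injective _ Subtype.coe_injective]
    rfl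

theorem nonempty_iso [Nontrivial V] [Nontrivial W] (hG : IsHubTree G s t x)
    (hH : IsHubTree H s' t' x') (card_eq : #t = #t')
    (h : excessParts G t = excessParts H t') : Nonempty (G ≃g H) := by
  obtain ⟨σ, hσ⟩ := exists_equiv_of_map_eq (map_excess_eq_of_excessParts_eq card_eq h)
  obtain ⟨parent, adj_iff, card_none, card_some⟩ := hG.exists_parent
  obtain ⟨parent', adj_iff', card_none', card_some'⟩ := hH.exists_parent
  obtain ⟨α, hα⟩ : ∃ α : s ≃ s', ∀ y, parent' (α y) = (parent y).map σ := by
    refine exists_equiv_of_card_fiber_eq fun c => ?_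
    obtain _ | b := c
    · simp only [Option.map_eq_none_iff, card_none, card_none']
    · obtain ⟨b, rfl⟩ := σ.surjective b
      simp only [Option.map_eq_some_iff, card_some', hσ, ← card_some, σ.injective.eq_iff,
        exists_eq_right]
  refine hG.toIsBipartition.nonempty_iso hH.toIsBipartition α σ fun y b => ?_
  rw [adj_iff, adj_iff', hα]
  simp [Option.map_eq_some_iff]

end IsHubTree

end HubTree

section TreeB

variable {p q k l : ℕ}

theorem treeB_adj_inl_inr (i : Fin p) (j : Fin q) :
    (treeB p q k l).Adj (.inl i) (.inr j) ↔ (i : ℕ) = 0 ∨ (j : ℕ) = treeBAttach k l i := by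
  simp [treeB]

theorem isBipartition_treeB :
    IsBipartition (treeB p q k l) (univ.map .inl) (univ.map .inr) where
  disjoint := Finset.disjoint_coe.2 (by simp [Finset.disjoint_left])
  mem_of_adj := by
    rintro (i | i) (j | j) <;> simp [treeB]
  mem_or_mem := by rintro (i | j) <;> simp

theorem isHubTree_treeB (hp : 0 < p) (hl : l + 2 ≤ q) :
    IsHubTree (treeB p q k l) (univ.map .inl) (univ.map .inr) (.inl ⟨0, hp⟩) := by
  refine isBipartition_treeB.isHubTree (by simp) (by simp [treeB_adj_inl_inr]) ?_
  simp only [Finset.mem_map, Finset.mem_univ, true_and, Function.Embedding.inl_apply,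
    forall_exists_index, forall_apply_eq_imp_iff, ne_eq, Sum.inl.injEq, Fin.ext_iff]
  intro i hi
  have attach_lt : treeBAttach k l i < q := by
    unfold treeBAttach
    split_ifs <;> omega
  refine ⟨.inr ⟨_, attach_lt⟩, (treeB_adj_inl_inr _ _).2 (.inr rfl), ?_⟩
  rintro (j | j) hj
  · simp [treeB] at hj
  · simpa [treeB_adj_inl_inr, hi, Fin.ext_iff] using hj

theorem isTreeWithBipartition_treeB (hp : 0 < p) (hl : l + 2 ≤ q) :
    IsTreeWithBipartition p q (treeB p q k l) := by
  have h := isHubTree_treeB (k := k) hp hl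
  refine ⟨h.isTree, _, _, h.toIsBipartiteWith, Set.eq_univ_of_forall h.mem_or_mem, ?_, ?_⟩
  · rw [Set.ncard_coe_finset, Finset.card_map, Finset.card_univ, Fintype.card_fin]
  · rw [Set.ncard_coe_finset, Finset.card_map, Finset.card_univ, Fintype.card_fin]

theorem excess_treeB_inr (hp : 0 < p) (j : Fin q) :
    excess (treeB p q k l) (.inr j) = #{i ∈ Finset.Ico 1 p | treeBAttach k l i = j} := by
  have neighborSet_eq : (treeB p q k l).neighborSet (.inr j) =
      (({i | (i : ℕ) = 0 ∨ (j : ℕ) = treeBAttach k l i} : Finset (Fin p)).map .inl :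
        Finset (Fin p ⊕ Fin q)) := by
    ext (i | i) <;> simp [treeB]
  have val_eq : ({i | (i : ℕ) = 0 ∨ (j : ℕ) = treeBAttach k l i} : Finset (Fin p)).map
      Fin.valEmbedding = insert 0 {i ∈ Finset.Ico 1 p | treeBAttach k l i = j} := by
    ext i
    simp only [Finset.mem_map, Finset.mem_filter, Finset.mem_univ, true_and,
      Fin.valEmbedding_apply, Fin.exists_iff, Finset.mem_insert, Finset.mem_Ico]
    grind
  rw [excess, neighborSet_eq, Set.ncard_coe_finset, Finset.card_map,
    ← Finset.card_map Fin.valEmbedding, val_eq, Finset.card_insert_of_notMem (by simp),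
    Nat.add_sub_cancel]

theorem card_filter_treeBAttach_eq (hkl : k + l + 1 ≤ p) (j : ℕ) :
    #{i ∈ Finset.Ico 1 p | treeBAttach k l i = j} =
      if j = 0 then p - 1 - k - l else if j = 1 then k else if j < l + 2 then 1 else 0 := by
  have fiber_eq : ({i ∈ Finset.Ico 1 p | treeBAttach k l i = j} : Finset ℕ) =
      if j = 0 then Finset.Ico (k + l + 1) p else if j = 1 then Finset.Ico 1 (k + 1)
      else if j < l + 2 then {k + j - 1} else ∅ := by
    ext i
    rw [Finset.mem_filter, Finset.mem_Ico]
    split_ifs <;> simp only [Finset.mem_Ico, Finset.mem_singleton, Finset.notMem_empty] <;>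
      grind [treeBAttach]
  rw [fiber_eq]
  split_ifs
  · rw [Nat.card_Ico]
    omega
  · exact Nat.card_Ico 1 (k + 1)
  · exact Finset.card_singleton _
  · exact Finset.card_empty

theorem excessParts_treeB (hkl : k + l + 1 ≤ p) (hl : l + 2 ≤ q) :
    excessParts (treeB p q k l) (univ.map .inr) =
      ((p - 1 - k - l) ::ₘ k ::ₘ Multiset.replicate l 1).filter (· ≠ 0) := by
  have excess_eq (j : Fin q) : excess (treeB p q k l) (.inr j) =
      if (j : ℕ) = 0 then p - 1 - k - l else if (j : ℕ) = 1 then k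
      else if (j : ℕ) < l + 2 then 1 else 0 := by
    rw [excess_treeB_inr (by omega), card_filter_treeBAttach_eq hkl]
  obtain ⟨r, rfl⟩ : ∃ r, q = l + r + 2 := ⟨q - (l + 2), by omega⟩
  have map_eq : (univ.map .inr).val.map (excess (treeB p (l + r + 2) k l)) =
      (p - 1 - k - l) ::ₘ k ::ₘ Multiset.replicate l 1 + Multiset.replicate r 0 := by
    simp [Function.comp_def, excess_eq, Fin.univ_val_map, List.ofFn_succ, List.ofFn_add,
      ← Multiset.coe_replicate]
  have filter_zeros : (Multiset.replicate r 0).filter (· ≠ 0) = 0 :=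
    Multiset.filter_eq_nil.2 fun a ha => by simpa using Multiset.eq_of_mem_replicate ha
  rw [excessParts, map_eq, Multiset.filter_add, filter_zeros, add_zero]

theorem excessParts_treeB_zero_zero (hp : 4 ≤ p) (hq : 4 ≤ q) :
    excessParts (treeB p q 0 0) (univ.map .inr) = {p - 1} := by
  rw [excessParts_treeB (by omega) (by omega)]
  simp [show p - 1 ≠ 0 by omega, Multiset.filter_singleton]

theorem excessParts_treeB_zero_one (hp : 4 ≤ p) (hq : 4 ≤ q) :
    excessParts (treeB p q 0 1) (univ.map .inr) = {p - 1 - 1, 1} := by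
  rw [excessParts_treeB (by omega) (by omega)]
  simp [show p - 1 - 1 ≠ 0 by omega]

theorem excessParts_treeB_two_zero (hp : 4 ≤ p) (hq : 4 ≤ q) :
    excessParts (treeB p q 2 0) (univ.map .inr) = {p - 1 - 2, 2} := by
  rw [excessParts_treeB (by omega) (by omega)]
  simp [show p - 1 - 2 ≠ 0 by omega]

theorem excessParts_treeB_zero_two (hp : 4 ≤ p) (hq : 4 ≤ q) :
    excessParts (treeB p q 0 2) (univ.map .inr) = {p - 1 - 2, 1, 1} := by
  rw [excessParts_treeB (by omega) (by omega)]
  simp [show p - 1 - 2 ≠ 0 by omega]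

theorem treeB_sBefore_treeB {k' l' : ℕ} (hp : 4 ≤ p) (hq : 4 ≤ q) (hl : l + 2 ≤ q)
    (hl' : l' + 2 ≤ q) (h : PowerSumLT (excessParts (treeB p q k l) (univ.map .inr))
      (excessParts (treeB p q k' l') (univ.map .inr))) :
    SBefore (treeB p q k l) (treeB p q k' l') :=
  (isHubTree_treeB (by omega) hl).sBefore_of_powerSumLT (isHubTree_treeB (by omega) hl') rfl rfl
    (by simp only [Fintype.card_sum, Fintype.card_fin]; omega) h

theorem treeB_zero_two_sBefore_two_zero (hp : 4 ≤ p) (hq : 4 ≤ q) :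
    SBefore (treeB p q 0 2) (treeB p q 2 0) := by
  refine treeB_sBefore_treeB hp hq (by omega) (by omega) (.inl ?_)
  rw [excessParts_treeB_zero_two hp hq, excessParts_treeB_two_zero hp hq]
  simp

theorem treeB_two_zero_sBefore_zero_one (hp : 5 ≤ p) (hq : 4 ≤ q) :
    SBefore (treeB p q 2 0) (treeB p q 0 1) := by
  refine treeB_sBefore_treeB (by omega) hq (by omega) (by omega) (.inl ?_)
  rw [excessParts_treeB_two_zero (by omega) hq, excessParts_treeB_zero_one (by omega) hq]
  obtain ⟨n, rfl⟩ := Nat.exists_eq_add_of_le' hp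
  simp only [Multiset.insert_eq_cons, powerSum_cons, powerSum_singleton, one_pow,
    Nat.add_one_sub_one, Nat.reduceSubDiff]
  nlinarith

theorem treeB_zero_two_sBefore_zero_one (hp : 4 ≤ p) (hq : 4 ≤ q) :
    SBefore (treeB p q 0 2) (treeB p q 0 1) := by
  refine treeB_sBefore_treeB hp hq (by omega) (by omega) (.inl ?_)
  rw [excessParts_treeB_zero_two hp hq, excessParts_treeB_zero_one hp hq]
  obtain ⟨n, rfl⟩ := Nat.exists_eq_add_of_le' hp
  simp only [Multiset.insert_eq_cons, powerSum_cons, powerSum_singleton, one_pow,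
    Nat.add_one_sub_one, Nat.reduceSubDiff]
  nlinarith

theorem treeB_zero_one_sBefore_zero_zero (hp : 4 ≤ p) (hq : 4 ≤ q) :
    SBefore (treeB p q 0 1) (treeB p q 0 0) := by
  refine treeB_sBefore_treeB hp hq (by omega) (by omega) (.inl ?_)
  rw [excessParts_treeB_zero_one hp hq, excessParts_treeB_zero_zero hp hq]
  obtain ⟨n, rfl⟩ := Nat.exists_eq_add_of_le' hp
  simp only [Multiset.insert_eq_cons, powerSum_cons, powerSum_singleton, one_pow,
    Nat.add_one_sub_one]
  nlinarith

end TreeB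

section Classification

variable {p q : ℕ} {V : Type*} {G : SimpleGraph V} {s t : Finset V}

theorem IsHubTree.nonempty_iso_treeB {k l : ℕ} {x : V} (hG : IsHubTree G s t x) (hs : #s = p)
    (ht : #t = q) (hl : l + 2 ≤ q)
    (h : excessParts G t = excessParts (treeB p q k l) (univ.map .inr)) :
    Nonempty (G ≃g treeB p q k l) := by
  have hp : 0 < p := hs ▸ Finset.card_pos.2 ⟨x, hG.hub_mem⟩
  have : Nontrivial (Fin p ⊕ Fin q) :=
    Fintype.one_lt_card_iff_nontrivial.1 (by simp only [Fintype.card_sum, Fintype.card_fin]; omega)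
  have := Fintype.ofEquiv _ hG.partsEquiv
  have : Nontrivial V := Fintype.one_lt_card_iff_nontrivial.1 (by rw [← hG.card_add_card]; omega)
  exact hG.nonempty_iso (isHubTree_treeB hp hl) (by simpa using ht) h

variable [Fintype V]

theorem IsHubTree.nonempty_iso_or_sBefore {x : V} (hG : IsHubTree G s t x) (hs : #s = p)
    (ht : #t = q) (hp : 4 ≤ p) (hq : 4 ≤ q) :
    (∃ B ∈ [treeB p q 0 2, treeB p q 2 0, treeB p q 0 1, treeB p q 0 0], Nonempty (G ≃g B)) ∨
      SBefore G (treeB p q 0 2) := by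
  have : Nontrivial V := Fintype.one_lt_card_iff_nontrivial.1 (by rw [← hG.card_add_card]; omega)
  have sum_eq : (excessParts G t).sum = p - 1 := by
    rw [sum_excessParts, hG.symm.sum_excess_left hG.isTree, hs]
  have := partition_eq_or_powerSumLT (zero_notMem_excessParts G t) (by omega)
  rw [sum_eq, ← excessParts_treeB_zero_zero hp hq, ← excessParts_treeB_zero_one hp hq,
    ← excessParts_treeB_two_zero hp hq, ← excessParts_treeB_zero_two hp hq] at this
  obtain h | h | h | h | h := this
  · exact .inl ⟨_, by simp, hG.nonempty_iso_treeB hs ht (by omega) h⟩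
  · exact .inl ⟨_, by simp, hG.nonempty_iso_treeB hs ht (by omega) h⟩
  · exact .inl ⟨_, by simp, hG.nonempty_iso_treeB hs ht (by omega) h⟩
  · exact .inl ⟨_, by simp, hG.nonempty_iso_treeB hs ht (by omega) h⟩
  · exact .inr (hG.sBefore_of_powerSumLT (isHubTree_treeB (by omega) (by omega)) (by simpa using hs)
      (by simpa using ht) (by rw [← hG.card_add_card]; omega) h)

theorem IsTreeWithBipartition.exists_isBipartition (h : IsTreeWithBipartition p q G) :
    ∃ s t : Finset V, IsBipartition G s t ∧ #s = p ∧ #t = q := by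
  classical
  obtain ⟨-, s, t, bipartite, union_eq, rfl, rfl⟩ := h
  refine ⟨s.toFinset, t.toFinset, ⟨by simpa using bipartite, fun v => ?_⟩,
    (Set.ncard_eq_toFinset_card' s).symm, (Set.ncard_eq_toFinset_card' t).symm⟩
  simpa using union_eq.ge (Set.mem_univ v)

theorem sBefore_treeB_of_excess_lt (hG : G.IsTree) (h : IsBipartition G s t) (hs : #s = p)
    (ht : #t = p) (hp : 4 ≤ p) (lt_left : ∀ v ∈ s, excess G v < p - 1)
    (lt_right : ∀ v ∈ t, excess G v < p - 1) : SBefore G (treeB p p 0 2) := by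
  have card_eq : Fintype.card V = p + p := by rw [← h.card_add_card, hs, ht]
  have : Nontrivial V := Fintype.one_lt_card_iff_nontrivial.1 (by omega)
  have : Nontrivial (Fin p ⊕ Fin p) :=
    Fintype.one_lt_card_iff_nontrivial.1 (by simp only [Fintype.card_sum, Fintype.card_fin]; omega)
  have hB := isHubTree_treeB (k := 0) (show 0 < p by omega) (show 2 + 2 ≤ p by omega)
  refine sBefore_of_sum_excess_sq_lt hG hB.isTree (by simpa using card_eq) (by omega) ?_
  have le_left := sum_sq_excess_le hG h (by rwa [ht])
  have le_right := sum_sq_excess_le hG h.symm (by rwa [hs])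
  rw [ht] at le_left
  rw [hs] at le_right
  rw [h.sum_univ, hB.sum_sq_excess, excessParts_treeB_zero_two hp hp]
  obtain ⟨n, rfl⟩ := Nat.exists_eq_add_of_le' hp
  simp only [Multiset.insert_eq_cons, powerSum_cons, powerSum_singleton, one_pow, Finset.card_map,
    Finset.card_univ, Fintype.card_fin, Nat.add_one_sub_one, Nat.reduceSubDiff]
    at le_left le_right ⊢
  nlinarith

theorem IsTreeWithBipartition.nonempty_iso_or_sBefore (hG : IsTreeWithBipartition p p G)
    (hp : 4 ≤ p) :
    (∃ B ∈ [treeB p p 0 2, treeB p p 2 0, treeB p p 0 1, treeB p p 0 0], Nonempty (G ≃g B)) ∨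
      SBefore G (treeB p p 0 2) := by
  obtain ⟨s, t, h, hs, ht⟩ := hG.exists_isBipartition
  have : Nontrivial V := Fintype.one_lt_card_iff_nontrivial.1 (by rw [← h.card_add_card]; omega)
  by_cases hub_left : ∃ x, IsHubTree G s t x
  · obtain ⟨x, hx⟩ := hub_left
    exact hx.nonempty_iso_or_sBefore hs ht hp hp
  by_cases hub_right : ∃ x, IsHubTree G t s x
  · obtain ⟨x, hx⟩ := hub_right
    exact hx.nonempty_iso_or_sBefore ht hs hp hp
  · refine .inr (sBefore_treeB_of_excess_lt hG.1 h hs ht hp (fun v hv => ?_) fun v hv => ?_)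
    · exact ht ▸ (h.excess_lt_or_isHubTree hG.1 hv).resolve_right fun hv => hub_left ⟨v, hv⟩
    · exact hs ▸ (h.symm.excess_lt_or_isHubTree hG.1 hv).resolve_right fun hv => hub_right ⟨v, hv⟩

theorem areLastTrees_cons {B : SimpleGraph (Fin p ⊕ Fin q)} {L : List (SimpleGraph (Fin p ⊕ Fin q))}
    (isTree : ∀ G ∈ B :: L, IsTreeWithBipartition p q G)
    (isChain : (B :: L).IsChain fun G H => SBefore G H)
    (iso_or_sBefore : ∀ (V : Type u) [Fintype V] (T : SimpleGraph V), IsTreeWithBipartition p q T →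
      (∃ G ∈ B :: L, Nonempty (T ≃g G)) ∨ SBefore T B) : AreLastTrees.{u} p q (B :: L) := by
  have : IsTrans (SimpleGraph (Fin p ⊕ Fin q)) fun G H => SBefore G H :=
    ⟨fun _ _ _ => SBefore.trans⟩
  have pairwise := List.isChain_iff_pairwise.1 isChain
  refine ⟨isTree, pairwise, fun V _ T hT not_iso G hG => ?_⟩
  have sBefore_head : SBefore T B := (iso_or_sBefore V T hT).resolve_left
    fun ⟨G, hG, iso⟩ => not_iso G hG iso
  obtain rfl | hG := List.mem_cons.1 hG
  · exact sBefore_head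
  · exact sBefore_head.trans (List.rel_of_pairwise_cons pairwise hG)

end Classification

theorem theorem3p2 (p q : ℕ) (hp : 4 ≤ p) (hpq : p = q) :
    (5 ≤ p → AreLastTrees.{u} p q [treeB p q 0 2, treeB p q 2 0, treeB p q 0 1, treeB p q 0 0]) ∧
    (p = 4 → Nonempty (treeB p q 2 0 ≃g treeB p q 0 1) ∧
      AreLastTrees.{u} p q [treeB p q 0 2, treeB p q 0 1, treeB p q 0 0]) := by
  subst hpq
  have isTree {k l : ℕ} (hl : l ≤ 2) : IsTreeWithBipartition p p (treeB p p k l) :=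
    isTreeWithBipartition_treeB (by omega) (by omega)
  refine ⟨fun five_le => areLastTrees_cons (by simp [isTree]) ?_ fun V _ T hT =>
    hT.nonempty_iso_or_sBefore hp, fun hp4 => ?_⟩
  · simp [treeB_zero_two_sBefore_two_zero hp hp, treeB_two_zero_sBefore_zero_one five_le hp,
      treeB_zero_one_sBefore_zero_zero hp hp]
  · have parts_eq : excessParts (treeB p p 2 0) (univ.map .inr) =
        excessParts (treeB p p 0 1) (univ.map .inr) := by
      rw [excessParts_treeB_two_zero hp hp, excessParts_treeB_zero_one hp hp, hp4]
      exact Multiset.pair_comm 1 2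
    obtain ⟨iso⟩ := (isHubTree_treeB (k := 2) (l := 0) (by omega) (by omega)).nonempty_iso_treeB
      (by simp) (by simp) (by omega) parts_eq
    refine ⟨⟨iso⟩, areLastTrees_cons (by simp [isTree]) ?_ fun V _ T hT => ?_⟩
    · simp [treeB_zero_two_sBefore_zero_one hp hp, treeB_zero_one_sBefore_zero_zero hp hp]
    · refine (hT.nonempty_iso_or_sBefore hp).imp_left ?_
      simp only [List.mem_cons, List.not_mem_nil, or_false, exists_eq_or_imp, exists_eq_left]
      rintro (h | ⟨⟨φ⟩⟩ | h)
      exacts [.inl h, .inr (.inl ⟨φ.trans iso⟩), .inr h]
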